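/- Throughout, \emph{countable} means finite or countably infinite, graphs are simple and undirected, and the random graph $\Gamma$ is the (unique up to isomorphism) countable graph such that for all disjoint finite sets $A,B$ of vertices there is a vertex $z\notin A\cup B$ adjacent to every vertex of $A$ and to no vertex of $B$. Let $\mathcal M$ be a graph or a linear order. An induced substructure $\mathcal N\subseteq\mathcal M$ is \emph{symmetrically embedded} in $\mathcal M$ if every automorphism of $\mathcal N$ extends to an automorphism of $\mathcal M$. The structure $\mathcal M$ is \emph{symmetrically indivisible} if for every coloring of its universe in two colors there is a monochromatic substructure $\mathcal M'\subseteq\mathcal M$ that is isomorphic to $\mathcal M$ and symmetrically embedded in $\mathcal M$. \begin{enumerate} \item For a graph $G$ let $\Gamma+G$ be the disjoint union of $\Gamma$ and $G$. Then for every countable graph $G$ the graph $\Gamma+G$ is countable and symmetrically indivisible, and $G\mapsto\Gamma+G$ induces a well-defined injective map from the set of isomorphism classes of countable graphs into the set of isomorphism classes of countable symmetrically indivisible graphs. The image of this map has cardinality $2^{\aleph_0}$. \item For a linear order $A$ let $\mathbb Q+\{x<y\}+A$ be the concatenation of $(\mathbb Q,<)$, a two-element chain and $A$, in this order. Then for every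 countable linear order $A$ the linear order $\mathbb Q+\{x<y\}+A$ is countable and symmetrically indivisible, and $A\mapsto\mathbb Q+\{x<y\}+A$ induces a well-defined injective map from the set of isomorphism classes of countable linear orders into the set of isomorphism classes of countable symmetrically indivisible linear orders. The image of this map has cardinality $2^{\aleph_0}$. \item Consequently there are exactly $2^{\aleph_0}$ isomorphism classes of countable symmetrically indivisible graphs, and exactly $2^{\aleph_0}$ isomorphism classes of countable symmetrically indivisible linear orders. \end{enumerate} -/

import Mathlib

universe u

/-- Symmetric indivisibility of a structure with universe `α` and one binary relation `r`: for every
colouring of `α` in two colours there is a monochromatic (induced) substructure, with universe `S`,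
that is isomorphic to the whole structure and symmetrically embedded in it, i.e. every
automorphism of the substructure extends to an automorphism of the whole structure. -/
def SymmetricallyIndivisible {α : Type*} (r : α → α → Prop) : Prop :=
  ∀ c : α → Bool, ∃ S : Set α,
    (∀ x ∈ S, ∀ y ∈ S, c x = c y) ∧
    Nonempty (Subrel r (· ∈ S) ≃r r) ∧
    ∀ σ : Subrel r (· ∈ S) ≃r Subrel r (· ∈ S), ∃ τ : r ≃r r, ∀ x : S, τ (x : α) = (σ x : α)

/-- `Γ` is (a copy of) the random graph: it is countable and has the extension property, i.e. for
all disjoint finite sets `A`, `B` of vertices some vertex outside `A ∪ B` is adjacent to every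
vertex of `A` and to no vertex of `B`. -/
def IsRandomGraph {W : Type*} (Γ : SimpleGraph W) : Prop :=
  Countable W ∧ ∀ A B : Finset W, Disjoint A B →
    ∃ z, z ∉ A ∧ z ∉ B ∧ (∀ a ∈ A, Γ.Adj z a) ∧ ∀ b ∈ B, ¬ Γ.Adj z b

/-- The random graph exists: join `i < j` when the `i`-th binary digit of `j` is `1`. -/
theorem exists_isRandomGraph : ∃ Γ : SimpleGraph ℕ, IsRandomGraph Γ := by
  refine ⟨SimpleGraph.fromRel fun i j : ℕ => j.testBit i = true, inferInstance, ?_⟩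
  intro A B hAB
  obtain ⟨m, hm⟩ : ∃ m : ℕ, ∀ x ∈ A ∪ B, x < m :=
    ⟨(A ∪ B).sup id + 1, fun x hx => Nat.lt_succ_of_le (Finset.le_sup (f := id) hx)⟩
  obtain ⟨z, hz⟩ : ∃ z : ℕ, ∀ i, z.testBit i = true ↔ i ∈ insert m A := by
    refine ⟨∑ i ∈ insert m A, 2 ^ i, fun i => ?_⟩
    rw [← Nat.mem_bitIndices]
    rw [← List.mem_toFinset, Finset.toFinset_bitIndices_sum_two_pow]
  have hmz : m < z := by
    have h : z.testBit m = true := (hz m).2 (Finset.mem_insert_self _ _)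
    exact lt_of_lt_of_le Nat.lt_two_pow_self (Nat.ge_two_pow_of_testBit h)
  have hlt : ∀ x ∈ A ∪ B, x < z := fun x hx => (hm x hx).trans hmz
  refine ⟨z, fun h => ?_, fun h => ?_, fun a ha => ?_, fun b hb => ?_⟩
  · exact lt_irrefl _ (hlt z (Finset.mem_union_left _ h))
  · exact lt_irrefl _ (hlt z (Finset.mem_union_right _ h))
  · rw [SimpleGraph.fromRel_adj]
    exact ⟨(hlt a (Finset.mem_union_left _ ha)).ne', Or.inr ((hz a).2 (Finset.mem_insert_of_mem ha))⟩
  · have hb' := Finset.mem_union_right A hb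
    rw [SimpleGraph.fromRel_adj]
    rintro ⟨-, h | h⟩
    · exact absurd ((hlt b hb').trans Nat.lt_two_pow_self)
        (not_lt.2 (Nat.ge_two_pow_of_testBit h))
    · rcases Finset.mem_insert.1 ((hz b).1 h) with h | h
      · exact (hm b hb').ne h
      · exact Finset.disjoint_left.1 hAB h hb

/-- Countable (finite or countably infinite) graphs. -/
structure CountableGraph : Type (u + 1) where
  V : Type u
  [countable : Countable V]
  graph : SimpleGraph V

attribute [instance] CountableGraph.countable

namespace CountableGraph

/-- Isomorphism of countable graphs. -/
instance isoSetoid : Setoid CountableGraph.{u} where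
  r G H := Nonempty (G.graph ≃g H.graph)
  iseqv := ⟨fun _ => ⟨RelIso.refl _⟩, fun ⟨e⟩ => ⟨e.symm⟩, fun ⟨e⟩ ⟨f⟩ => ⟨e.trans f⟩⟩

/-- Isomorphism classes of countable graphs. -/
abbrev IsoClass : Type (u + 1) := Quotient isoSetoid.{u}

/-- Isomorphism classes of countable symmetrically indivisible graphs. -/
abbrev SymIndivIsoClass : Type (u + 1) :=
  {q : IsoClass.{u} // ∃ G : CountableGraph.{u}, ⟦G⟧ = q ∧ SymmetricallyIndivisible G.graph.Adj}

/-- The disjoint union `Γ + G`. -/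
def disjointUnion {W : Type} [Countable W] (Γ : SimpleGraph W) (G : CountableGraph.{u}) :
    CountableGraph.{u} where
  V := W ⊕ G.V
  graph := Γ.sum G.graph

end CountableGraph

/-- Countable (finite or countably infinite) linear orders. -/
structure CountableLinearOrder : Type (u + 1) where
  carrier : Type u
  [countable : Countable carrier]
  [order : LinearOrder carrier]

attribute [instance] CountableLinearOrder.countable CountableLinearOrder.order

namespace CountableLinearOrder

/-- Isomorphism of countable linear orders. -/
instance isoSetoid : Setoid CountableLinearOrder.{u} where
  r A B := Nonempty (A.carrier ≃o B.carrier)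
  iseqv := ⟨fun _ => ⟨OrderIso.refl _⟩, fun ⟨e⟩ => ⟨e.symm⟩, fun ⟨e⟩ ⟨f⟩ => ⟨e.trans f⟩⟩

/-- Isomorphism classes of countable linear orders. -/
abbrev IsoClass : Type (u + 1) := Quotient isoSetoid.{u}

/-- Isomorphism classes of countable symmetrically indivisible linear orders. -/
abbrev SymIndivIsoClass : Type (u + 1) :=
  {q : IsoClass.{u} // ∃ A : CountableLinearOrder.{u},
    ⟦A⟧ = q ∧ SymmetricallyIndivisible (fun x y : A.carrier => x < y)}

/-- The concatenation `ℚ + {x < y} + A`, with `Fin 2` as the two-element chain. -/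
noncomputable def concat (A : CountableLinearOrder.{u}) : CountableLinearOrder.{u} where
  carrier := (ℚ ⊕ₗ Fin 2) ⊕ₗ A.carrier
  countable := inferInstanceAs (Countable ((ℚ ⊕ Fin 2) ⊕ A.carrier))
  order := Sum.Lex.linearOrder

end CountableLinearOrder

/-! Indivisibility: the whole structure `M` is re-embedded in its homogeneous summand (`Γ` or `ℚ`),
in one colour, so that every automorphism of the copy extends to that summand; the identity on the
remaining summands completes the extension.

In `Γ`, one colour realises all types over finite sets extending some fixed finite type. A generic
construction inside that colour embeds `M` so that the traces on the copy of the vertices outside it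
are exactly the finite and cofinite sets, each realised generically. This family of traces is
invariant under all automorphisms of `M`, so back and forth extends them
(`IsRandomGraph.exists_generic_embedding`, `SimpleGraph.exists_extension_of_generic`).

In `ℚ`, one colour is dense in some interval, which by Cantor's theorem is a copy of `M ×ₗ ℚ`. One
point of that colour is picked in each fibre; automorphisms of `M` act by permuting and translating
fibres, and the result extends by the identity outside the interval
(`Rat.exists_monochromatic_copy`).

Injectivity: an isomorphism `Γ + G → Γ + G'` may exchange `Γ` with a copy of it inside the other
summand, but a detour of one step through `Γ` repairs this. In the orders, the two-element chain is
the first pair of neighbours, so isomorphisms preserve it and what lies above it.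

Counting: a countable structure is coded by subsets of `ℕ` and `ℕ × ℕ`; conversely a subset of `ℕ`
is recovered from the degrees of a union of cliques, or from the lengths of the maximal finite
chains of covers in an order. -/

/-- To show symmetric indivisibility it suffices to find, for every colouring, a monochromatic
self-embedding along which every automorphism extends. -/
theorem symmetricallyIndivisible_of_embedding {α : Type*} {r : α → α → Prop}
    (h : ∀ c : α → Bool, ∃ f : r ↪r r, (∀ x y, c (f x) = c (f y)) ∧
      ∀ σ : r ≃r r, ∃ τ : r ≃r r, ∀ x, τ (f x) = f (σ x)) :
    SymmetricallyIndivisible r := by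
  intro c
  obtain ⟨f, hc, hf⟩ := h c
  let e : r ≃r Subrel r (· ∈ Set.range f) :=
    ⟨Equiv.ofInjective f f.injective, fun {a b} => f.map_rel_iff⟩
  have he : ∀ x, ((e x : Set.range f) : α) = f x := fun x => rfl
  refine ⟨Set.range f, ?_, ⟨e.symm⟩, fun σ => ?_⟩
  · rintro _ ⟨x, rfl⟩ _ ⟨y, rfl⟩
    exact hc x y
  · obtain ⟨τ, hτ⟩ := hf ((e.trans σ).trans e.symm)
    refine ⟨τ, fun x => ?_⟩
    obtain ⟨y, rfl⟩ := e.surjective x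
    rw [he, hτ, ← he]
    simp

/-! ### Generic sequences and back and forth. -/

/-- A monotone sequence meeting countably many cofinal properties. -/
theorem exists_monotone_seq_meeting {P ι : Type*} [Preorder P] [Countable ι] (p₀ : P)
    (D : ι → P → Prop) (hD : ∀ i p, ∃ q, p ≤ q ∧ D i q) :
    ∃ v : ℕ → P, Monotone v ∧ ∀ i, ∃ n, D i (v n) := by
  classical
  have := Encodable.ofCountable ι
  let C : ι → Order.Cofinal P := fun i => ⟨{q | D i q}, fun p => by
    obtain ⟨q, h1, h2⟩ := hD i p
    exact ⟨q, h2, h1⟩⟩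
  exact ⟨Order.sequenceOfCofinals p₀ C, Order.sequenceOfCofinals.monotone p₀ C,
    fun i => ⟨_, Order.sequenceOfCofinals.encode_mem p₀ C i⟩⟩

/-- Back and forth for finite sets of pairs that are pairwise related by `R`. -/
theorem exists_equiv_of_back_and_forth {X Y : Type*} [Countable X] [Countable Y]
    (R : X × Y → X × Y → Prop) (hR : ∀ p q, R p q → (p.1 = q.1 ↔ p.2 = q.2))
    (forth : ∀ s : Finset (X × Y), (∀ p ∈ s, ∀ q ∈ s, R p q) → ∀ x, ∃ t : Finset (X × Y),
      s ⊆ t ∧ (∀ p ∈ t, ∀ q ∈ t, R p q) ∧ ∃ y, (x, y) ∈ t)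
    (back : ∀ s : Finset (X × Y), (∀ p ∈ s, ∀ q ∈ s, R p q) → ∀ y, ∃ t : Finset (X × Y),
      s ⊆ t ∧ (∀ p ∈ t, ∀ q ∈ t, R p q) ∧ ∃ x, (x, y) ∈ t) :
    ∃ e : X ≃ Y, ∀ x x', R (x, e x) (x', e x') := by
  let P := {s : Finset (X × Y) // ∀ p ∈ s, ∀ q ∈ s, R p q}
  obtain ⟨v, hv, hD⟩ := exists_monotone_seq_meeting (P := P) (ι := X ⊕ Y) ⟨∅, by simp⟩
    (fun i s => i.elim (fun x => ∃ y, (x, y) ∈ s.1) (fun y => ∃ x, (x, y) ∈ s.1)) (by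
      rintro (x | y) ⟨s, hs⟩
      · obtain ⟨t, h1, h2, h3⟩ := forth s hs x
        exact ⟨⟨t, h2⟩, h1, h3⟩
      · obtain ⟨t, h1, h2, h3⟩ := back s hs y
        exact ⟨⟨t, h2⟩, h1, h3⟩)
  have hRel : ∀ n m p q, p ∈ (v n).1 → q ∈ (v m).1 → R p q := fun n m p q hp hq =>
    (v (max n m)).2 p (hv (le_max_left n m) hp) q (hv (le_max_right n m) hq)
  choose n f hf using fun x => hD (Sum.inl x)
  choose m g hg using fun y => hD (Sum.inr y)
  refine ⟨⟨f, g, fun x => ?_, fun y => ?_⟩, fun x x' => hRel _ _ _ _ (hf x) (hf x')⟩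
  · exact (hR _ _ (hRel _ _ _ _ (hg (f x)) (hf x))).2 rfl
  · exact (hR _ _ (hRel _ _ _ _ (hf (g y)) (hg y))).1 rfl

/-! ### Generic embeddings into the random graph. -/

/-- `z` lies outside `A` and `B`, is adjacent to all of `A` and to none of `B`. -/
def SimpleGraph.Separates {W : Type*} (Γ : SimpleGraph W) (A B : Finset W) (z : W) : Prop :=
  z ∉ A ∧ z ∉ B ∧ (∀ a ∈ A, Γ.Adj z a) ∧ ∀ b ∈ B, ¬ Γ.Adj z b

theorem SimpleGraph.Separates.mono {W : Type*} {Γ : SimpleGraph W} {A B A' B' : Finset W} {z : W}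
    (h : Γ.Separates A B z) (hA : A' ⊆ A) (hB : B' ⊆ B) : Γ.Separates A' B' z :=
  ⟨fun h' => h.1 (hA h'), fun h' => h.2.1 (hB h'), fun a ha => h.2.2.1 a (hA ha),
    fun b hb => h.2.2.2 b (hB hb)⟩

/-- One of the two colours meets every type over a set extending a fixed finite base. -/
theorem IsRandomGraph.exists_rich_colour {W : Type*} {Γ : SimpleGraph W} (hΓ : IsRandomGraph Γ)
    (c : W → Bool) : ∃ (b : Bool) (A₀ B₀ : Finset W), Disjoint A₀ B₀ ∧
      ∀ A B : Finset W, Disjoint A B → A₀ ⊆ A → B₀ ⊆ B → ∃ z, c z = b ∧ Γ.Separates A B z := by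
  by_cases h : ∀ A B : Finset W, Disjoint A B → ∃ z, c z = true ∧ Γ.Separates A B z
  · exact ⟨true, ∅, ∅, by simp, fun A B hAB _ _ => h A B hAB⟩
  · push Not at h
    obtain ⟨A₀, B₀, h0, h⟩ := h
    -- The base is a type that `true` omits: a vertex realising an extension of it realises it too,
    -- so it cannot have colour `true`.
    refine ⟨false, A₀, B₀, h0, fun A B hAB hA hB => ?_⟩
    obtain ⟨z, hz⟩ := hΓ.2 A B hAB
    refine ⟨z, ?_, hz⟩
    by_contra hc
    exact h z (by simpa using hc) (SimpleGraph.Separates.mono hz hA hB)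

/-- Finite approximations to an embedding of `H` into `Γ` with values in `P`, together with two
finite sets of vertices (`D true` and `D false`) that later values are adjacent,
respectively not adjacent, to. -/
structure EmbeddingApprox {K W : Type*} (H : SimpleGraph K) (Γ : SimpleGraph W) (P : W → Prop)
    (A₀ B₀ : Finset W) where
  graphOn : Finset (K × W)
  D : Bool → Finset W
  disjoint : Disjoint (D true) (D false)
  base_true : A₀ ⊆ D true
  base_false : B₀ ⊆ D false
  mem : ∀ p ∈ graphOn, P p.2
  notMem : ∀ p ∈ graphOn, ∀ b, p.2 ∉ D b
  inj : ∀ p ∈ graphOn, ∀ q ∈ graphOn, p.1 = q.1 ↔ p.2 = q.2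
  adj : ∀ p ∈ graphOn, ∀ q ∈ graphOn, H.Adj p.1 q.1 ↔ Γ.Adj p.2 q.2

namespace EmbeddingApprox

variable {K W : Type*} {H : SimpleGraph K} {Γ : SimpleGraph W} {P : W → Prop} {A₀ B₀ : Finset W}

/-- The last clause binds only pairs added later. Hence a vertex put into `D true` ends up with a
cofinite trace on the copy, and one put into `D false` with a finite trace. -/
instance : Preorder (EmbeddingApprox H Γ P A₀ B₀) where
  le p q := p.graphOn ⊆ q.graphOn ∧ (∀ b, p.D b ⊆ q.D b) ∧
    ∀ x ∈ q.graphOn, x ∉ p.graphOn → ∀ b, ∀ w ∈ p.D b, (Γ.Adj x.2 w ↔ b = true)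
  le_refl p := ⟨subset_rfl, fun _ => subset_rfl, fun _ h h' => absurd h h'⟩
  le_trans p q r hpq hqr := ⟨hpq.1.trans hqr.1, fun b => (hpq.2.1 b).trans (hqr.2.1 b),
    fun x hx hx' b w hw => by
      by_cases h : x ∈ q.graphOn
      · exact hpq.2.2 x h hx' b w hw
      · exact hqr.2.2 x hx h b w (hpq.2.1 b hw)⟩

/-- The new value must respect both the promises in `D` and the adjacencies to earlier values. The
resulting type contains the base `A₀`, `B₀`, so `hP` realises it in `P`. -/
theorem exists_le_dom (hP : ∀ A B : Finset W, Disjoint A B → A₀ ⊆ A → B₀ ⊆ B →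
      ∃ z, P z ∧ Γ.Separates A B z) (p : EmbeddingApprox H Γ P A₀ B₀) (k : K) :
    ∃ q, p ≤ q ∧ ∃ w, (k, w) ∈ q.graphOn := by
  classical
  by_cases hk : ∃ w, (k, w) ∈ p.graphOn
  · exact ⟨p, le_rfl, hk⟩
  push Not at hk
  let s : Bool → Finset W := fun b =>
    (p.graphOn.filter fun x => (H.Adj k x.1 ↔ b = true)).image Prod.snd
  have hs : ∀ b w, w ∈ s b ↔ ∃ j, (j, w) ∈ p.graphOn ∧ (H.Adj k j ↔ b = true) := by
    intro b w
    simp [s]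
  obtain ⟨z, hz, hzA, hzB, hadj, hnadj⟩ := hP (p.D true ∪ s true) (p.D false ∪ s false) (by
    rw [Finset.disjoint_left]
    intro w h1 h2
    rw [Finset.mem_union, hs] at h1 h2
    rcases h1 with h1 | ⟨j, hj, h1⟩ <;> rcases h2 with h2 | ⟨i, hi, h2⟩
    · exact Finset.disjoint_left.1 p.disjoint h1 h2
    · exact p.notMem _ hi _ h1
    · exact p.notMem _ hj _ h2
    · have : j = i := (p.inj _ hj _ hi).2 rfl
      subst this
      simp_all) (p.base_true.trans Finset.subset_union_left)
      (p.base_false.trans Finset.subset_union_left)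
  rw [Finset.mem_union, not_or] at hzA hzB
  have hzD : ∀ b, z ∉ p.D b := by rintro (_ | _) <;> tauto
  have hzs : ∀ j, (j, z) ∉ p.graphOn := by
    intro j hj
    by_cases h : H.Adj k j
    · exact hzA.2 ((hs _ _).2 ⟨j, hj, by simpa using h⟩)
    · exact hzB.2 ((hs _ _).2 ⟨j, hj, by simpa using h⟩)
  have hnew : ∀ j w, (j, w) ∈ p.graphOn → (H.Adj k j ↔ Γ.Adj z w) := by
    intro j w hj
    by_cases h : H.Adj k j
    · exact iff_of_true h
        (hadj w (Finset.mem_union_right _ ((hs _ _).2 ⟨j, hj, by simpa using h⟩)))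
    · exact iff_of_false h
        (hnadj w (Finset.mem_union_right _ ((hs _ _).2 ⟨j, hj, by simpa using h⟩)))
  refine ⟨⟨insert (k, z) p.graphOn, p.D, p.disjoint, p.base_true, p.base_false, ?_, ?_, ?_, ?_⟩,
    ⟨Finset.subset_insert _ _, fun _ => subset_rfl, ?_⟩, z, Finset.mem_insert_self _ _⟩
  · rintro ⟨j, w⟩ h
    rcases Finset.mem_insert.1 h with h | h
    · cases h; exact hz
    · exact p.mem _ h
  · rintro ⟨j, w⟩ h b
    rcases Finset.mem_insert.1 h with h | h
    · cases h; exact hzD b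
    · exact p.notMem _ h b
  · rintro ⟨j, w⟩ h ⟨j', w'⟩ h'
    rcases Finset.mem_insert.1 h with h | h <;> rcases Finset.mem_insert.1 h' with h' | h'
    · cases h; cases h'; simp
    · cases h
      refine iff_of_false ?_ ?_
      · rintro rfl; exact hk _ h'
      · rintro rfl; exact hzs _ h'
    · cases h'
      refine iff_of_false ?_ ?_
      · rintro rfl; exact hk _ ‹_›
      · rintro rfl; exact hzs _ ‹_›
    · exact p.inj _ h _ h'
  · rintro ⟨j, w⟩ h ⟨j', w'⟩ h'
    rcases Finset.mem_insert.1 h with h | h <;> rcases Finset.mem_insert.1 h' with h' | h'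
    · cases h; cases h'; simp
    · cases h; exact hnew _ _ h'
    · cases h'
      rw [H.adj_comm, Γ.adj_comm]
      exact hnew _ _ h
    · exact p.adj _ h _ h'
  · rintro ⟨j, w⟩ h h' b y hy
    rcases Finset.mem_insert.1 h with h | h
    · cases h
      cases b
      · simpa using hnadj y (Finset.mem_union_left _ hy)
      · simpa using hadj y (Finset.mem_union_left _ hy)
    · exact absurd h h'

/-- A fresh vertex may be put into either of the two finite sets. -/
theorem exists_le_insert (p : EmbeddingApprox H Γ P A₀ B₀) (b : Bool) (w : W)
    (hw : ∀ b, w ∉ p.D b) (hw' : ∀ k, (k, w) ∉ p.graphOn) :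
    ∃ q, p ≤ q ∧ w ∈ q.D b ∧ q.graphOn = p.graphOn := by
  classical
  refine ⟨⟨p.graphOn, fun b' => if b' = b then insert w (p.D b') else p.D b', ?_, ?_, ?_, p.mem,
    ?_, p.inj, p.adj⟩, ⟨subset_rfl, ?_, fun x hx hx' => absurd hx hx'⟩, ?_, rfl⟩
  · have h1 := hw true
    have h2 := hw false
    cases b <;> simp [h1, h2, p.disjoint]
  · split_ifs
    · exact p.base_true.trans (Finset.subset_insert _ _)
    · exact p.base_true
  · split_ifs
    · exact p.base_false.trans (Finset.subset_insert _ _)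
    · exact p.base_false
  · rintro ⟨k, y⟩ h b'
    dsimp only
    split_ifs
    · rw [Finset.mem_insert, not_or]
      refine ⟨?_, p.notMem _ h b'⟩
      rintro rfl
      exact hw' _ h
    · exact p.notMem _ h b'
  · intro b'
    dsimp only
    split_ifs
    · exact Finset.subset_insert _ _
    · exact subset_rfl
  · simp

theorem exists_le_cover (p : EmbeddingApprox H Γ P A₀ B₀) (w : W) :
    ∃ q, p ≤ q ∧ ((∃ b, w ∈ q.D b) ∨ ∃ k, (k, w) ∈ q.graphOn) := by
  by_cases h : (∃ b, w ∈ p.D b) ∨ ∃ k, (k, w) ∈ p.graphOn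
  · exact ⟨p, le_rfl, h⟩
  · push Not at h
    obtain ⟨q, h1, h2, -⟩ := p.exists_le_insert false w h.1 h.2
    exact ⟨q, h1, Or.inl ⟨_, h2⟩⟩

/-- Serves the genericity requirement: `z` is placed in `D b`, which settles its adjacency to all
later values, so only the finitely many present values need care. -/
theorem exists_le_separates (hΓ : IsRandomGraph Γ) (p : EmbeddingApprox H Γ P A₀ B₀)
    (b : Bool) (A B : Finset W) (hAB : Disjoint A B) :
    ∃ q, p ≤ q ∧ ∃ z ∈ q.D b, Γ.Separates A B z ∧
      ∀ x ∈ q.graphOn, x.2 ∉ A → x.2 ∉ B → (Γ.Adj z x.2 ↔ b = true) := by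
  classical
  -- All vertices used so far. Those not decided by `A` and `B` are decided according to `b`, which
  -- also forces `z ∉ N`.
  let N : Finset W := p.D true ∪ p.D false ∪ p.graphOn.image Prod.snd
  obtain ⟨z, hz⟩ := hΓ.2 (A ∪ N.filter fun w => b = true ∧ w ∉ B)
    (B ∪ N.filter fun w => b = false ∧ w ∉ A) (by
      rw [Finset.disjoint_left] at hAB ⊢
      intro w h1 h2
      have := @hAB w
      simp only [Finset.mem_union, Finset.mem_filter] at h1 h2
      cases b <;> simp at h1 h2 <;> tauto)
  have hzN : z ∉ N := by
    intro h
    have h1 := hz.1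
    have h2 := hz.2.1
    simp only [Finset.mem_union, Finset.mem_filter] at h1 h2
    cases b <;> tauto
  obtain ⟨q, h1, h2, h3⟩ := p.exists_le_insert b z (by
    rintro (_ | _) h <;> apply hzN <;> simp [N, h]) (by
    intro k h
    apply hzN
    simp only [N, Finset.mem_union, Finset.mem_image]
    exact Or.inr ⟨_, h, rfl⟩)
  refine ⟨q, h1, z, h2, SimpleGraph.Separates.mono hz Finset.subset_union_left
    Finset.subset_union_left, ?_⟩
  rw [h3]
  intro x hx hA hB
  have hxN : x.2 ∈ N := Finset.mem_union_right _ (Finset.mem_image_of_mem _ hx)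
  cases b
  · have := hz.2.2.2 x.2 (Finset.mem_union_right _ (by simp [hxN, hA]))
    simpa using this
  · have := hz.2.2.1 x.2 (Finset.mem_union_right _ (by simp [hxN, hB]))
    simpa using this

end EmbeddingApprox

/-- Every countable graph embeds into a rich part of the random graph in such a way that exactly
the finite and the cofinite subsets are traces of outside vertices, all of them generically. -/
theorem IsRandomGraph.exists_generic_embedding {K W : Type*} [Countable K] {H : SimpleGraph K}
    {Γ : SimpleGraph W} (hΓ : IsRandomGraph Γ) {P : W → Prop} {A₀ B₀ : Finset W}
    (h₀ : Disjoint A₀ B₀)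
    (hP : ∀ A B : Finset W, Disjoint A B → A₀ ⊆ A → B₀ ⊆ B → ∃ z, P z ∧ Γ.Separates A B z) :
    ∃ g : H ↪g Γ, (∀ k, P (g k)) ∧
      (∀ w, w ∉ Set.range g → ∃ (b : Bool) (F : Finset K),
        ∀ k, Γ.Adj w (g k) ↔ (b = true ↔ k ∉ F)) ∧
      ∀ (b : Bool) (F : Finset K) (A B : Finset W), Disjoint A B → (∀ k, g k ∉ A) →
        (∀ k, g k ∉ B) → ∃ z, z ∉ Set.range g ∧ Γ.Separates A B z ∧
          ∀ k, Γ.Adj z (g k) ↔ (b = true ↔ k ∉ F) := by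
  classical
  have := hΓ.1
  obtain ⟨v, hv, hD⟩ := exists_monotone_seq_meeting
    (P := EmbeddingApprox H Γ P A₀ B₀) (ι := K ⊕ W ⊕ (Bool × Finset W × Finset W))
    ⟨∅, fun b => if b = true then A₀ else B₀, by simpa using h₀, by simp, by simp, by simp,
      by simp, by simp, by simp⟩
    (fun i q => match i with
      | Sum.inl k => ∃ w, (k, w) ∈ q.graphOn
      | Sum.inr (Sum.inl w) => (∃ b, w ∈ q.D b) ∨ ∃ k, (k, w) ∈ q.graphOn
      | Sum.inr (Sum.inr (b, A, B)) => Disjoint A B → ∃ z ∈ q.D b, Γ.Separates A B z ∧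
          ∀ x ∈ q.graphOn, x.2 ∉ A → x.2 ∉ B → (Γ.Adj z x.2 ↔ b = true))
    (by
      rintro (k | w | ⟨b, A, B⟩) p
      · exact p.exists_le_dom hP k
      · exact p.exists_le_cover w
      · by_cases h : Disjoint A B
        · obtain ⟨q, h1, h2⟩ := p.exists_le_separates hΓ b A B h
          exact ⟨q, h1, fun _ => h2⟩
        · exact ⟨p, le_rfl, fun h' => absurd h' h⟩)
  choose n g hg using fun k => hD (Sum.inl k)
  have hinj : ∀ k j, g k = g j → k = j := fun k j h =>
    ((v (max (n k) (n j))).inj _ ((hv (le_max_left _ _)).1 (hg k)) _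
      ((hv (le_max_right _ _)).1 (hg j))).2 h
  have hadj : ∀ k j, Γ.Adj (g k) (g j) ↔ H.Adj k j := fun k j =>
    ((v (max (n k) (n j))).adj _ ((hv (le_max_left _ _)).1 (hg k)) _
      ((hv (le_max_right _ _)).1 (hg j))).symm
  have hgv : ∀ m k w, (k, w) ∈ (v m).graphOn → w = g k := fun m k w h =>
    ((v (max m (n k))).inj _ ((hv (le_max_left _ _)).1 h) _
      ((hv (le_max_right _ _)).1 (hg k))).1 rfl
  have hout : ∀ m b w, w ∈ (v m).D b → ∀ k, g k ≠ w := by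
    rintro m b w hw k rfl
    exact (v (max m (n k))).notMem _ ((hv (le_max_right _ _)).1 (hg k)) b
      ((hv (le_max_left _ _)).2.1 b hw)
  have hlate : ∀ m b w, w ∈ (v m).D b → ∀ k, (k, g k) ∉ (v m).graphOn →
      (Γ.Adj w (g k) ↔ b = true) := by
    intro m b w hw k hk
    rw [Γ.adj_comm]
    exact (hv (le_max_left m (n k))).2.2 _ ((hv (le_max_right _ _)).1 (hg k)) hk b w hw
  refine ⟨⟨⟨g, fun k j => hinj k j⟩, fun {k j} => hadj k j⟩, fun k => (v (n k)).mem _ (hg k),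
    ?_, ?_⟩
  · intro w hw
    obtain ⟨m, ⟨b, hb⟩ | ⟨k, hk⟩⟩ := hD (Sum.inr (Sum.inl w))
    · refine ⟨b, ((v m).graphOn.image Prod.fst).filter fun k => ¬ (Γ.Adj w (g k) ↔ b = true),
        fun k => ?_⟩
      change Γ.Adj w (g k) ↔ _
      rw [Finset.mem_filter]
      have h2 : (∀ x, (k, x) ∉ (v m).graphOn) → (Γ.Adj w (g k) ↔ b = true) :=
        fun h => hlate m b w hb k (h _)
      have h3 : k ∈ (v m).graphOn.image Prod.fst ↔ ∃ x, (k, x) ∈ (v m).graphOn := by simp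
      rw [h3]
      by_cases h4 : ∃ x, (k, x) ∈ (v m).graphOn
      · tauto
      · push Not at h4
        have := h2 h4
        have h5 : ¬ ∃ x, (k, x) ∈ (v m).graphOn := by push Not; exact h4
        tauto
    · exact absurd ⟨k, (hgv m k w hk).symm⟩ hw
  · intro b F A B hAB hA hB
    have hA : ∀ k, g k ∉ A := hA
    have hB : ∀ k, g k ∉ B := hB
    -- The wanted trace is `F` if `b` is false and its complement if `b` is true, so the exceptional
    -- set `F.image g` joins the side opposite to the default.
    obtain ⟨m, hm⟩ := hD (Sum.inr (Sum.inr (b, A ∪ (if b = true then ∅ else F.image g),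
      B ∪ (if b = true then F.image g else ∅))))
    obtain ⟨z, hz, hsep, hz'⟩ := hm (by
      rw [Finset.disjoint_left] at hAB ⊢
      intro w
      cases b <;> simp <;> grind)
    refine ⟨z, ?_, hsep.mono Finset.subset_union_left Finset.subset_union_left, fun k => ?_⟩
    · rintro ⟨k, hk⟩
      exact hout m b z hz k hk
    · change Γ.Adj z (g k) ↔ _
      have hFk : g k ∈ F.image g ↔ k ∈ F := by
        rw [Finset.mem_image]
        exact ⟨fun ⟨j, hj, h⟩ => hinj _ _ h ▸ hj, fun h => ⟨k, h, rfl⟩⟩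
      by_cases hk : k ∈ F
      · have h1 := hsep.2.2.1 (g k)
        have h2 := hsep.2.2.2 (g k)
        rw [Finset.mem_union] at h1 h2
        cases b <;> simp [hFk, hk, hA, hB] at h1 h2 ⊢ <;> assumption
      · have h1 : Γ.Adj z (g k) ↔ b = true := by
          by_cases h : (k, g k) ∈ (v m).graphOn
          · refine hz' _ h ?_ ?_
            · cases b <;> simp [hA]; grind
            · cases b <;> simp [hB]; grind
          · exact hlate m b z hz k h
        simp [h1, hk]

/-- An automorphism of the generically embedded graph extends to the random graph. -/
theorem SimpleGraph.exists_extension_of_generic {K W : Type*} [Countable W] {H : SimpleGraph K}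
    {Γ : SimpleGraph W} (g : H ↪g Γ)
    (h1 : ∀ w, w ∉ Set.range g → ∃ (b : Bool) (F : Finset K),
        ∀ k, Γ.Adj w (g k) ↔ (b = true ↔ k ∉ F))
    (h2 : ∀ (b : Bool) (F : Finset K) (A B : Finset W), Disjoint A B → (∀ k, g k ∉ A) →
        (∀ k, g k ∉ B) → ∃ z, z ∉ Set.range g ∧ Γ.Separates A B z ∧
          ∀ k, Γ.Adj z (g k) ↔ (b = true ↔ k ∉ F)) (σ : H ≃g H) :
    ∃ τ : Γ ≃g Γ, ∀ k, τ (g k) = g (σ k) := by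
  classical
  -- The last two clauses concern `p` alone: the pair agrees with `σ` on the copy, and `σ` carries
  -- the trace of `p.1` to that of `p.2`.
  let R : (H ≃g H) → W × W → W × W → Prop := fun σ p q =>
    (p.1 = q.1 ↔ p.2 = q.2) ∧ (Γ.Adj p.1 q.1 ↔ Γ.Adj p.2 q.2) ∧
    (∀ k, p.1 = g k ↔ p.2 = g (σ k)) ∧ ∀ k, Γ.Adj p.1 (g k) ↔ Γ.Adj p.2 (g (σ k))
  have forth : ∀ σ, ∀ s : Finset (W × W), (∀ p ∈ s, ∀ q ∈ s, R σ p q) → ∀ x,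
      ∃ y, ∀ p ∈ insert (x, y) s, ∀ q ∈ insert (x, y) s, R σ p q := by
    intro σ s hs x
    suffices h : ∃ y, (∀ k, x = g k ↔ y = g (σ k)) ∧ (∀ k, Γ.Adj x (g k) ↔ Γ.Adj y (g (σ k))) ∧
        ∀ p ∈ s, (x = p.1 ↔ y = p.2) ∧ (Γ.Adj x p.1 ↔ Γ.Adj y p.2) by
      obtain ⟨y, hy1, hy2, hy3⟩ := h
      refine ⟨y, fun p hp q hq => ?_⟩
      rcases Finset.mem_insert.1 hp with rfl | hp <;> rcases Finset.mem_insert.1 hq with rfl | hq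
      · exact ⟨by simp, by simp, hy1, hy2⟩
      · exact ⟨(hy3 q hq).1, (hy3 q hq).2, hy1, hy2⟩
      · refine ⟨?_, ?_, (hs p hp p hp).2.2⟩
        · rw [eq_comm, (hy3 p hp).1, eq_comm]
        · rw [Γ.adj_comm, (hy3 p hp).2, Γ.adj_comm]
      · exact hs p hp q hq
    by_cases hx : x ∈ Set.range g
    · obtain ⟨k, rfl⟩ := hx
      refine ⟨g (σ k), fun j => by simp,
        fun j => by rw [g.map_adj_iff, g.map_adj_iff, σ.map_adj_iff], fun p hp => ?_⟩
      have h := (hs p hp p hp).2.2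
      refine ⟨?_, ?_⟩
      · rw [eq_comm, h.1 k, eq_comm]
      · rw [Γ.adj_comm, h.2 k, Γ.adj_comm]
    by_cases hxs : ∃ y, (x, y) ∈ s
    · obtain ⟨y, hy⟩ := hxs
      exact ⟨y, (hs _ hy _ hy).2.2.1, (hs _ hy _ hy).2.2.2,
        fun p hp => ⟨(hs _ hy p hp).1, (hs _ hy p hp).2.1⟩⟩
    push Not at hxs
    obtain ⟨b, F, hF⟩ := h1 x hx
    -- Only partners outside the copy are listed: adjacency to the copy is prescribed by the image
    -- of `F` under `σ`, and `h2` requires sets disjoint from the copy.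
    let t : Bool → Finset W := fun b => (s.filter fun p => (Γ.Adj x p.1 ↔ b = true) ∧
      p.1 ∉ Set.range g).image Prod.snd
    have ht : ∀ b w, w ∈ t b ↔ ∃ j, (j, w) ∈ s ∧ (Γ.Adj x j ↔ b = true) ∧ j ∉ Set.range g := by
      intro b w
      simp [t]
    have hrange : ∀ p ∈ s, (p.1 ∈ Set.range g ↔ p.2 ∈ Set.range g) := by
      intro p hp
      have h := (hs p hp p hp).2.2.1
      constructor
      · rintro ⟨k, hk⟩
        exact ⟨σ k, ((h k).1 hk.symm).symm⟩
      · rintro ⟨k, hk⟩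
        refine ⟨σ.symm k, ((h (σ.symm k)).2 ?_).symm⟩
        simpa using hk.symm
    have htr : ∀ b k, g k ∉ t b := by
      intro b k h
      obtain ⟨j, hj, -, h3⟩ := (ht _ _).1 h
      exact h3 ((hrange _ hj).2 ⟨k, rfl⟩)
    obtain ⟨z, hz, hsep, hzF⟩ := h2 b (F.map σ.toEquiv.toEmbedding) (t true) (t false) (by
      rw [Finset.disjoint_left]
      intro w hw1 hw2
      obtain ⟨j, hj, h3, -⟩ := (ht _ _).1 hw1
      obtain ⟨i, hi, h4, -⟩ := (ht _ _).1 hw2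
      have : j = i := (hs _ hj _ hi).1.2 rfl
      subst this
      simp_all) (htr _) (htr _)
    have hzk : ∀ k, Γ.Adj x (g k) ↔ Γ.Adj z (g (σ k)) := by
      intro k
      rw [hF, hzF]
      have : σ k ∈ F.map σ.toEquiv.toEmbedding ↔ k ∈ F :=
        Finset.mem_map' σ.toEquiv.toEmbedding
      rw [this]
    refine ⟨z, fun k => ?_, hzk, fun p hp => ?_⟩
    · exact iff_of_false (fun h => hx ⟨k, h.symm⟩) (fun h => hz ⟨_, h.symm⟩)
    by_cases hpr : p.1 ∈ Set.range g
    · obtain ⟨k, hk⟩ := hpr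
      have h := ((hs p hp p hp).2.2.1 k).1 hk.symm
      rw [← hk, h]
      exact ⟨iff_of_false (fun h => hx ⟨k, h.symm⟩) (fun h => hz ⟨_, h.symm⟩), hzk k⟩
    · have hx1 : x ≠ p.1 := by
        rintro rfl
        exact hxs p.2 hp
      by_cases hxp : Γ.Adj x p.1
      · have hm : p.2 ∈ t true := (ht _ _).2 ⟨p.1, hp, by simpa using hxp, hpr⟩
        refine ⟨iff_of_false hx1 ?_, iff_of_true hxp (hsep.2.2.1 _ hm)⟩
        rintro rfl
        exact hsep.1 hm
      · have hm : p.2 ∈ t false := (ht _ _).2 ⟨p.1, hp, by simpa using hxp, hpr⟩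
        refine ⟨iff_of_false hx1 ?_, iff_of_false hxp (hsep.2.2.2 _ hm)⟩
        rintro rfl
        exact hsep.2.1 hm
  -- Swapping coordinates turns the back step for `σ` into the forth step for `σ.symm`.
  have hsymm : ∀ σ p q, R σ p q → R σ.symm p.swap q.swap := by
    intro σ p q h
    refine ⟨h.1.symm, h.2.1.symm, fun k => ?_, fun k => ?_⟩
    · simpa using (h.2.2.1 (σ.symm k)).symm
    · simpa using (h.2.2.2 (σ.symm k)).symm
  obtain ⟨e, he⟩ := exists_equiv_of_back_and_forth (R σ) (fun p q h => h.1)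
    (fun s hs x => by
      obtain ⟨y, hy⟩ := forth σ s hs x
      exact ⟨_, Finset.subset_insert _ _, hy, y, Finset.mem_insert_self _ _⟩)
    (fun s hs y => by
      obtain ⟨x, hx⟩ := forth σ.symm (s.image Prod.swap) (by
        intro p hp q hq
        obtain ⟨p', hp', rfl⟩ := Finset.mem_image.1 hp
        obtain ⟨q', hq', rfl⟩ := Finset.mem_image.1 hq
        exact hsymm σ p' q' (hs p' hp' q' hq')) y
      have hmem : ∀ p ∈ insert (x, y) s, p.swap ∈ insert (y, x) (s.image Prod.swap) := by
        intro p hp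
        rcases Finset.mem_insert.1 hp with rfl | hp
        · exact Finset.mem_insert_self _ _
        · exact Finset.mem_insert_of_mem (Finset.mem_image_of_mem _ hp)
      refine ⟨insert (x, y) s, Finset.subset_insert _ _, fun p hp q hq => ?_, x,
        Finset.mem_insert_self _ _⟩
      exact hsymm σ.symm _ _ (hx _ (hmem p hp) _ (hmem q hq)))
  exact ⟨⟨e, fun {a b} => (he a b).2.1.symm⟩, fun k => ((he (g k) (g k)).2.2.1 k).1 rfl⟩

/-! ### The graphs `Γ + G`. -/

namespace CountableGraph

/-- The disjoint union of the random graph and a countable graph is symmetrically indivisible. -/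
theorem symmetricallyIndivisible_disjointUnion {W : Type} [Countable W] {Γ : SimpleGraph W}
    (hΓ : IsRandomGraph Γ) (G : CountableGraph.{u}) :
    SymmetricallyIndivisible (G.disjointUnion Γ).graph.Adj := by
  refine symmetricallyIndivisible_of_embedding fun c => ?_
  obtain ⟨b, A₀, B₀, h0, hP⟩ := hΓ.exists_rich_colour (fun w => c (Sum.inl w))
  -- The graph embedded in `Γ` is all of `Γ + G`, so the extension may fix the summand `G`
  -- pointwise.
  obtain ⟨g, hg, h1, h2⟩ := hΓ.exists_generic_embedding
    (H := (G.disjointUnion Γ).graph) h0 hP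
  refine ⟨g.trans SimpleGraph.Embedding.sumInl, fun x y => (hg x).trans (hg y).symm, fun σ => ?_⟩
  obtain ⟨τ, hτ⟩ := SimpleGraph.exists_extension_of_generic g h1 h2 σ
  exact ⟨SimpleGraph.Iso.sumCongr τ (RelIso.refl _), fun x => congrArg Sum.inl (hτ x)⟩

/-- The summand `G` of `Γ + G` is determined up to isomorphism. -/
theorem iso_of_disjointUnion_iso {W : Type} [Countable W] {Γ : SimpleGraph W}
    (hΓ : IsRandomGraph Γ) {G G' : CountableGraph.{u}}
    (e : (G.disjointUnion Γ).graph ≃g (G'.disjointUnion Γ).graph) :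
    Nonempty (G.graph ≃g G'.graph) := by
  classical
  -- If `f` sends a vertex of the second summand into `Γ`, apply `f` once more to the vertex
  -- reached.
  let Rel : ∀ {V V' : Type u}, (W ⊕ V → W ⊕ V') → V → V' → Prop := fun f v v' =>
    f (Sum.inr v) = Sum.inr v' ∨ ∃ w, f (Sum.inr v) = Sum.inl w ∧ f (Sum.inl w) = Sum.inr v'
  have hex : ∀ {G G' : CountableGraph.{u}}
      (f : (Γ.sum G.graph) ≃g (Γ.sum G'.graph)), ∀ v, ∃ v', Rel f v v' := by
    intro G G' f v
    rcases h : f (Sum.inr v) with w | v'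
    · rcases h' : f (Sum.inl w) with w' | v'
      · exfalso
        -- A second landing in `Γ` is impossible: the preimage of a common neighbour of `w` and `w'`
        -- would be adjacent to vertices in both summands.
        obtain ⟨z, -, -, hz, -⟩ := hΓ.2 {w, w'} ∅ (by simp)
        have hz1 : (Γ.sum G'.graph).Adj (Sum.inl z) (f (Sum.inr v)) := by
          rw [h]; exact hz w (by simp)
        have hz2 : (Γ.sum G'.graph).Adj (Sum.inl z) (f (Sum.inl w)) := by
          rw [h']; exact hz w' (by simp)
        obtain ⟨y, hy⟩ := f.surjective (Sum.inl z)
        rw [← hy, f.map_adj_iff] at hz1 hz2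
        rcases y with y | y
        · simp at hz1
        · simp at hz2
      · exact ⟨v', Or.inr ⟨w, h, h'⟩⟩
    · exact ⟨v', Or.inl h⟩
  have hsymm : ∀ {G G' : CountableGraph.{u}}
      (f : (Γ.sum G.graph) ≃g (Γ.sum G'.graph)), ∀ v v', Rel f v v' → Rel f.symm v' v := by
    rintro G G' f v v' (h | ⟨w, h, h'⟩)
    · exact Or.inl (by rw [← h]; exact f.symm_apply_apply _)
    · exact Or.inr ⟨w, by rw [← h']; exact f.symm_apply_apply _,
        by rw [← h]; exact f.symm_apply_apply _⟩
  have huniq : ∀ {V V' : Type u} (f : W ⊕ V → W ⊕ V') v v₁ v₂,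
      Rel f v v₁ → Rel f v v₂ → v₁ = v₂ := by
    rintro V V' f v v₁ v₂ (h | ⟨w, h, h'⟩) (k | ⟨x, k, k'⟩) <;> rw [h] at k <;> cases k
    · rfl
    · rw [h'] at k'; cases k'; rfl
  have hadj : ∀ v₁ v₂ v₁' v₂', Rel e v₁ v₁' → Rel e v₂ v₂' →
      (G'.graph.Adj v₁' v₂' ↔ G.graph.Adj v₁ v₂) := by
    have he : ∀ x y, (Γ.sum G'.graph).Adj (e x) (e y) ↔ (Γ.sum G.graph).Adj x y :=
      fun x y => e.map_adj_iff
    intro v₁ v₂ v₁' v₂' h₁ h₂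
    have h0 := he (Sum.inr v₁) (Sum.inr v₂)
    rcases h₁ with h | ⟨w, h, h'⟩ <;> rcases h₂ with k | ⟨x, k, k'⟩
    · rw [h, k] at h0; exact h0
    · have h3 := he (Sum.inr v₁) (Sum.inl x)
      rw [h, k] at h0
      rw [h, k'] at h3
      exact h3.trans h0
    · have h3 := he (Sum.inl w) (Sum.inr v₂)
      rw [h, k] at h0
      rw [h', k] at h3
      exact h3.trans h0
    · have h3 := he (Sum.inl w) (Sum.inl x)
      rw [h, k] at h0
      rw [h', k'] at h3
      exact h3.trans h0
  choose f hf using hex (G := G) (G' := G') e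
  choose g hg using hex (G := G') (G' := G) e.symm
  refine ⟨⟨⟨f, g, fun v => ?_, fun v => ?_⟩, fun {a b} => hadj _ _ _ _ (hf a) (hf b)⟩⟩
  · exact huniq e.symm _ _ _ (hg (f v)) (hsymm (G := G) (G' := G') e _ _ (hf v))
  · exact huniq e _ _ _ (hf (g v)) (hsymm (G := G') (G' := G) e.symm _ _ (hg v))

end CountableGraph

/-! ### Monochromatic copies in `ℚ`. -/

/-- Automorphisms of an open interval extend by the identity. -/
theorem OrderIso.exists_extend_Ioo {α : Type*} [LinearOrder α] {a b : α}
    (e : Set.Ioo a b ≃o Set.Ioo a b) : ∃ τ : α ≃o α, ∀ x : Set.Ioo a b, τ x = e x := by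
  classical
  let t : Equiv.Perm α := Equiv.Perm.ofSubtype (p := (· ∈ Set.Ioo a b)) e.toEquiv
  have hin : ∀ x (hx : x ∈ Set.Ioo a b), t x = e ⟨x, hx⟩ := fun x hx =>
    Equiv.Perm.ofSubtype_apply_of_mem _ hx
  have hout : ∀ x, x ∉ Set.Ioo a b → t x = x := fun x hx =>
    Equiv.Perm.ofSubtype_apply_of_not_mem _ hx
  have hmono : StrictMono t := by
    intro x y hxy
    by_cases hx : x ∈ Set.Ioo a b <;> by_cases hy : y ∈ Set.Ioo a b
    · rw [hin x hx, hin y hy]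
      exact e.strictMono (show (⟨x, hx⟩ : Set.Ioo a b) < ⟨y, hy⟩ from hxy)
    · rw [hin x hx, hout y hy]
      have : b ≤ y := not_lt.1 fun h => hy ⟨hx.1.trans hxy, h⟩
      exact (e ⟨x, hx⟩).2.2.trans_le this
    · rw [hout x hx, hin y hy]
      have : x ≤ a := not_lt.1 fun h => hx ⟨h, hxy.trans hy.2⟩
      exact this.trans_lt (e ⟨y, hy⟩).2.1
    · rwa [hout x hx, hout y hy]
  exact ⟨hmono.orderIsoOfSurjective t t.surjective, fun x => hin x x.2⟩

/-- Some colour is dense in some interval of `ℚ`. -/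
theorem Rat.exists_dense_colour (c : ℚ → Bool) : ∃ (a b : ℚ) (i : Bool), a < b ∧
    ∀ x y, a ≤ x → x < y → y ≤ b → ∃ q, x < q ∧ q < y ∧ c q = i := by
  by_cases h : ∀ x y : ℚ, x < y → ∃ q, x < q ∧ q < y ∧ c q = true
  · exact ⟨0, 1, true, one_pos, fun x y _ hxy _ => h x y hxy⟩
  · push Not at h
    obtain ⟨a, b, hab, h⟩ := h
    refine ⟨a, b, false, hab, fun x y hx hxy hy => ?_⟩
    obtain ⟨q, h1, h2⟩ := exists_between hxy
    exact ⟨q, h1, h2, by simpa using h q (hx.trans_lt h1) (h2.trans_le hy)⟩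

/-- An automorphism of `K` acts on `K ×ₗ ℚ`, with the points `(k, d k)` permuted. -/
theorem Prod.Lex.exists_orderIso_translate {K : Type*} [LinearOrder K] (σ : K ≃o K) (d : K → ℚ) :
    ∃ τ : K ×ₗ ℚ ≃o K ×ₗ ℚ, ∀ k, τ (toLex (k, d k)) = toLex (σ k, d (σ k)) := by
  -- The fibre over `k` goes to the fibre over `σ k` by translation by `d (σ k) - d k`.
  let t : K ×ₗ ℚ → K ×ₗ ℚ := fun x =>
    toLex (σ (ofLex x).1, (ofLex x).2 - d (ofLex x).1 + d (σ (ofLex x).1))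
  have hmono : StrictMono t := by
    intro x y hxy
    rw [Prod.Lex.lt_iff] at hxy
    rw [Prod.Lex.toLex_lt_toLex]
    rcases hxy with h | ⟨h, h'⟩
    · exact Or.inl (σ.strictMono h)
    · refine Or.inr ⟨congrArg σ h, ?_⟩
      dsimp only
      rw [h]
      linarith
  have hsurj : Function.Surjective t := by
    intro y
    refine ⟨toLex (σ.symm (ofLex y).1, (ofLex y).2 - d (ofLex y).1 + d (σ.symm (ofLex y).1)), ?_⟩
    simp [t]
  exact ⟨hmono.orderIsoOfSurjective t hsurj, fun k => by simp [t]⟩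

/-- Every countable linear order has a monochromatic copy in `ℚ` along which all automorphisms
extend. -/
theorem Rat.exists_monochromatic_copy {K : Type*} [LinearOrder K] [Countable K] [Nonempty K]
    (c : ℚ → Bool) : ∃ f : K → ℚ, StrictMono f ∧ (∀ x y, c (f x) = c (f y)) ∧
      ∀ σ : K ≃o K, ∃ τ : ℚ ≃o ℚ, ∀ x, τ (f x) = f (σ x) := by
  obtain ⟨a, b, i, hab, hd⟩ := Rat.exists_dense_colour c
  have : Nonempty (Set.Ioo a b) := (Set.nonempty_Ioo.2 hab).to_subtype
  have : Countable (K ×ₗ ℚ) := inferInstanceAs (Countable (K × ℚ))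
  have : Nonempty (K ×ₗ ℚ) := inferInstanceAs (Nonempty (K × ℚ))
  obtain ⟨φ⟩ := Order.iso_of_countable_dense (K ×ₗ ℚ) (Set.Ioo a b)
  have hex : ∀ k : K, ∃ q : ℚ, c (φ (toLex (k, q))) = i := by
    intro k
    have hlt : φ (toLex (k, 0)) < φ (toLex (k, 1)) :=
      φ.strictMono (Prod.Lex.toLex_lt_toLex.2 (Or.inr ⟨rfl, one_pos⟩))
    -- A point between the images of `(k, 0)` and `(k, 1)` comes from the fibre over `k`, since
    -- fibres are convex.
    obtain ⟨q, h1, h2, hq⟩ := hd _ _ (φ (toLex (k, 0))).2.1.le hlt (φ (toLex (k, 1))).2.2.le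
    obtain ⟨x, hx⟩ := φ.surjective
      ⟨q, (φ (toLex (k, 0))).2.1.trans h1, h2.trans (φ (toLex (k, 1))).2.2⟩
    obtain ⟨⟨j, r⟩, rfl⟩ := toLex.surjective x
    have h1' : φ (toLex (k, 0)) < φ (toLex (j, r)) := by rw [hx]; exact h1
    have h2' : φ (toLex (j, r)) < φ (toLex (k, 1)) := by rw [hx]; exact h2
    rw [φ.lt_iff_lt, Prod.Lex.toLex_lt_toLex] at h1' h2'
    have hjk : j = k := by
      rcases h1' with h | h
      · rcases h2' with h' | h'
        · exact absurd (h.trans h') (lt_irrefl _)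
        · exact h'.1
      · exact h.1.symm
    subst hjk
    exact ⟨r, by rw [hx]; exact hq⟩
  choose d hd' using hex
  refine ⟨fun k => φ (toLex (k, d k)), fun k j h => ?_, fun x y => (hd' x).trans (hd' y).symm,
    fun σ => ?_⟩
  · exact φ.strictMono (Prod.Lex.toLex_lt_toLex.2 (Or.inl h))
  · obtain ⟨τ, hτ⟩ := Prod.Lex.exists_orderIso_translate σ d
    obtain ⟨ρ, hρ⟩ := OrderIso.exists_extend_Ioo ((φ.symm.trans τ).trans φ)
    refine ⟨ρ, fun k => ?_⟩
    rw [hρ]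
    simp [hτ]

/-! ### The orders `ℚ + {x < y} + A`. -/

namespace CountableLinearOrder

/-- The linear order `ℚ + {x < y} + A` is symmetrically indivisible. -/
theorem symmetricallyIndivisible_concat (A : CountableLinearOrder.{u}) :
    SymmetricallyIndivisible (fun x y : A.concat.carrier => x < y) := by
  refine symmetricallyIndivisible_of_embedding fun c => ?_
  let ι : ℚ → A.concat.carrier := fun q => toLex (Sum.inl (toLex (Sum.inl q)))
  have hι : StrictMono ι := fun x y h => Sum.Lex.inl_lt_inl_iff.2 (Sum.Lex.inl_lt_inl_iff.2 h)
  have : Nonempty A.concat.carrier := ⟨ι 0⟩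
  obtain ⟨f, hf, hc, hτ⟩ := Rat.exists_monochromatic_copy (K := A.concat.carrier) fun q => c (ι q)
  refine ⟨(OrderEmbedding.ofStrictMono _ (hι.comp hf)).ltEmbedding, hc, fun σ => ?_⟩
  obtain ⟨τ, h⟩ := hτ (OrderIso.ofRelIsoLT σ)
  refine ⟨((τ.sumLexCongr (OrderIso.refl (Fin 2))).sumLexCongr
    (OrderIso.refl A.carrier)).toRelIsoLT, fun x => ?_⟩
  exact congrArg ι (h x)

variable {A A' : CountableLinearOrder.{u}}

/-- The lower element of the two-element chain. -/
def chainBot (A : CountableLinearOrder.{u}) : A.concat.carrier :=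
  toLex (Sum.inl (toLex (Sum.inr 0)))

/-- The upper element of the two-element chain. -/
def chainTop (A : CountableLinearOrder.{u}) : A.concat.carrier :=
  toLex (Sum.inl (toLex (Sum.inr 1)))

/-- The inclusion of the last summand. -/
def inLast (A : CountableLinearOrder.{u}) (a : A.carrier) : A.concat.carrier :=
  toLex (Sum.inr a)

theorem inLast_lt {a b : A.carrier} : A.inLast a < A.inLast b ↔ a < b :=
  Sum.Lex.inr_lt_inr_iff

theorem inLast_injective : Function.Injective A.inLast := fun _ _ h => Sum.inr_injective h

theorem chainTop_lt_iff {z : A.concat.carrier} : A.chainTop < z ↔ ∃ a, z = A.inLast a := by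
  constructor
  · intro h
    rcases z with (q | j) | a
    · exact absurd (Sum.Lex.inl_lt_inl_iff.1 h) Sum.Lex.not_inr_lt_inl
    · have h2 : (1 : Fin 2) < j := Sum.Lex.inr_lt_inr_iff.1 (Sum.Lex.inl_lt_inl_iff.1 h)
      omega
    · exact ⟨a, rfl⟩
  · rintro ⟨a, rfl⟩
    exact Sum.Lex.inl_lt_inr _ _

theorem chain_covBy : A.chainBot ⋖ A.chainTop := by
  refine ⟨Sum.Lex.inl_lt_inl_iff.2 (Sum.Lex.inr_lt_inr_iff.2 (by decide)), ?_⟩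
  intro z h1 h2
  rcases z with (q | j) | a
  · exact Sum.Lex.not_inr_lt_inl (Sum.Lex.inl_lt_inl_iff.1 h1)
  · have h3 : (0 : Fin 2) < j := Sum.Lex.inr_lt_inr_iff.1 (Sum.Lex.inl_lt_inl_iff.1 h1)
    have h4 : j < (1 : Fin 2) := Sum.Lex.inr_lt_inr_iff.1 (Sum.Lex.inl_lt_inl_iff.1 h2)
    omega
  · exact Sum.Lex.not_inr_lt_inl h2

/-- Nothing below the two-element chain is covered. -/
theorem not_covBy_of_lt_chainBot {x z : A.concat.carrier} (hx : x < A.chainBot) : ¬ x ⋖ z := by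
  rcases x with (q | j) | a
  · intro h
    rcases z with (r | j) | a
    · have hqr : q < r := Sum.Lex.inl_lt_inl_iff.1 (Sum.Lex.inl_lt_inl_iff.1 h.lt)
      obtain ⟨s, h1, h2⟩ := exists_between hqr
      exact h.2 (c := toLex (Sum.inl (toLex (Sum.inl s))))
        (Sum.Lex.inl_lt_inl_iff.2 (Sum.Lex.inl_lt_inl_iff.2 h1))
        (Sum.Lex.inl_lt_inl_iff.2 (Sum.Lex.inl_lt_inl_iff.2 h2))
    · exact h.2 (c := toLex (Sum.inl (toLex (Sum.inl (q + 1)))))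
        (Sum.Lex.inl_lt_inl_iff.2 (Sum.Lex.inl_lt_inl_iff.2 (lt_add_one q)))
        (Sum.Lex.inl_lt_inl_iff.2 (Sum.Lex.inl_lt_inr _ _))
    · exact h.2 (c := toLex (Sum.inl (toLex (Sum.inl (q + 1)))))
        (Sum.Lex.inl_lt_inl_iff.2 (Sum.Lex.inl_lt_inl_iff.2 (lt_add_one q)))
        (Sum.Lex.inl_lt_inr _ _)
  · have h2 : j < (0 : Fin 2) := Sum.Lex.inr_lt_inr_iff.1 (Sum.Lex.inl_lt_inl_iff.1 hx)
    omega
  · exact absurd hx Sum.Lex.not_inr_lt_inl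

/-- `chainBot` is the least element that some element covers, and covers are preserved by
isomorphisms. -/
theorem map_chainBot_le (f : A.concat.carrier ≃o A'.concat.carrier) :
    A'.chainBot ≤ f A.chainBot := by
  by_contra h
  exact not_covBy_of_lt_chainBot (not_le.1 h) ((apply_covBy_apply_iff f).2 chain_covBy)

/-- The bound for `f` and for `f.symm` fixes the image of `chainBot`; in a linear order an element
is covered by at most one other. -/
theorem map_chainTop (f : A.concat.carrier ≃o A'.concat.carrier) :
    f A.chainTop = A'.chainTop := by
  have h : f A.chainBot = A'.chainBot :=
    le_antisymm (f.le_symm_apply.1 (map_chainBot_le f.symm)) (map_chainBot_le f)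
  have h1 : f A.chainBot ⋖ f A.chainTop := (apply_covBy_apply_iff f).2 chain_covBy
  rw [h] at h1
  exact h1.unique_right chain_covBy

/-- The summand `A` of `ℚ + {x < y} + A` is determined up to isomorphism. -/
theorem iso_of_concat_iso (f : A.concat.carrier ≃o A'.concat.carrier) :
    Nonempty (A.carrier ≃o A'.carrier) := by
  have hex : ∀ {A A' : CountableLinearOrder.{u}} (f : A.concat.carrier ≃o A'.concat.carrier),
      ∀ a, ∃ a', f (A.inLast a) = A'.inLast a' := by
    intro A A' f a
    rw [← chainTop_lt_iff, ← map_chainTop f, f.lt_iff_lt, chainTop_lt_iff]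
    exact ⟨a, rfl⟩
  choose g hg using hex f
  have hmono : StrictMono g := by
    intro a b h
    rw [← inLast_lt, ← hg, ← hg, f.lt_iff_lt]
    exact inLast_lt.2 h
  refine ⟨hmono.orderIsoOfSurjective g fun a' => ?_⟩
  obtain ⟨a, ha⟩ := hex f.symm a'
  refine ⟨a, inLast_injective ?_⟩
  rw [← hg, ← ha, f.apply_symm_apply]

end CountableLinearOrder

/-! ### Counting isomorphism classes. -/

/-- A code of a relation on a countable type by subsets of `ℕ` and `ℕ × ℕ`. -/
noncomputable def relCode {α : Type*} [Countable α] (r : α → α → Prop) : Set ℕ × Set (ℕ × ℕ) :=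
  (Set.range (Classical.choose (exists_injective_nat α)),
    {p | ∃ x y, r x y ∧ Classical.choose (exists_injective_nat α) x = p.1 ∧
      Classical.choose (exists_injective_nat α) y = p.2})

/-- Matching points with the same number is an isomorphism. The code depends on a chosen numbering
and is no invariant; only this direction is needed, as one representative per class gets coded. -/
theorem relIso_of_relCode_eq {α β : Type*} [Countable α] [Countable β] {r : α → α → Prop}
    {s : β → β → Prop} (h : relCode r = relCode s) : Nonempty (r ≃r s) := by
  have hi := Classical.choose_spec (exists_injective_nat α)
  have hj := Classical.choose_spec (exists_injective_nat β)
  rw [relCode, relCode] at h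
  generalize Classical.choose (exists_injective_nat α) = i at hi h
  generalize Classical.choose (exists_injective_nat β) = j at hj h
  obtain ⟨h1, h2⟩ := Prod.ext_iff.1 h
  have h1 : Set.range i = Set.range j := h1
  have hf : ∀ x, ∃ y, j y = i x := fun x => h1.subset (Set.mem_range_self x)
  have hg : ∀ y, ∃ x, i x = j y := fun y => h1.superset (Set.mem_range_self y)
  choose f hf using hf
  choose g hg using hg
  have hri : ∀ x y, (i x, i y) ∈ {p : ℕ × ℕ | ∃ x y, r x y ∧ i x = p.1 ∧ i y = p.2} ↔ r x y := by
    refine fun x y => ⟨?_, fun h => ⟨x, y, h, rfl, rfl⟩⟩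
    rintro ⟨x', y', h, hx, hy⟩
    rwa [hi hx, hi hy] at h
  have hsj : ∀ x y, (j x, j y) ∈ {p : ℕ × ℕ | ∃ x y, s x y ∧ j x = p.1 ∧ j y = p.2} ↔ s x y := by
    refine fun x y => ⟨?_, fun h => ⟨x, y, h, rfl, rfl⟩⟩
    rintro ⟨x', y', h, hx, hy⟩
    rwa [hj hx, hj hy] at h
  refine ⟨⟨⟨f, g, fun x => hi ?_, fun y => hj ?_⟩, fun {x y} => ?_⟩⟩
  · rw [hg, hf]
  · rw [hf, hg]
  · change s (f x) (f y) ↔ _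
    rw [← hsj, ← hri, hf, hf]
    exact (Set.ext_iff.1 h2 _).symm

theorem Cardinal.mk_le_two_power_aleph0_of_relCode {T : Type*} {f : T → Set ℕ × Set (ℕ × ℕ)}
    (hf : Function.Injective f) : Cardinal.mk T ≤ 2 ^ Cardinal.aleph0 := by
  have h := Cardinal.lift_mk_le_lift_mk_of_injective hf
  simpa using h

theorem Cardinal.two_power_aleph0_le_mk_of_injective {T : Type*} {f : Set ℕ → T}
    (hf : Function.Injective f) : 2 ^ Cardinal.aleph0 ≤ Cardinal.mk T := by
  have h := Cardinal.lift_mk_le_lift_mk_of_injective hf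
  simpa using h

namespace CountableGraph

/-- The disjoint union of complete graphs with `n + 1` vertices, for `n ∈ X`. -/
def cliqueUnion (X : Set ℕ) : CountableGraph.{u} where
  V := ULift (Σ n : X, Fin (n + 1))
  graph :=
    { Adj := fun a b => a.down.1 = b.down.1 ∧ a ≠ b
      symm := ⟨fun _ _ h => ⟨h.1.symm, h.2.symm⟩⟩
      loopless := ⟨fun _ h => h.2 rfl⟩ }

theorem ncard_neighborSet_cliqueUnion (X : Set ℕ) (a : (cliqueUnion.{u} X).V) :
    ((cliqueUnion X).graph.neighborSet a).ncard = a.down.1 := by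
  obtain ⟨⟨n, k⟩⟩ := a
  have h : (cliqueUnion X).graph.neighborSet ⟨⟨n, k⟩⟩ =
      (fun j : Fin (n + 1) => (⟨⟨n, j⟩⟩ : ULift (Σ n : X, Fin (n + 1)))) '' {k}ᶜ := by
    ext ⟨⟨m, j⟩⟩
    constructor
    · rintro ⟨h1, h2⟩
      have h1 : n = m := h1
      subst h1
      refine ⟨j, ?_, rfl⟩
      rintro rfl
      exact h2 rfl
    · rintro ⟨i, hi, h⟩
      cases h
      refine ⟨rfl, fun h => hi ?_⟩
      cases h
      rfl
  have hinj : Function.Injective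
      (fun j : Fin (n + 1) => (⟨⟨n, j⟩⟩ : ULift (Σ n : X, Fin (n + 1)))) := by
    intro i j h
    cases h
    rfl
  have hcard : ({k}ᶜ : Set (Fin (n + 1))).ncard = n := by
    rw [Set.ncard_compl]
    simp
  rw [h]
  exact (Set.ncard_image_of_injective _ hinj).trans hcard

/-- Recovers `X` as the set of degrees, an isomorphism invariant. -/
theorem mem_iff_exists_ncard_neighborSet (X : Set ℕ) (n : ℕ) :
    n ∈ X ↔ ∃ a, ((cliqueUnion.{u} X).graph.neighborSet a).ncard = n := by
  constructor
  · exact fun h => ⟨⟨⟨⟨n, h⟩, 0⟩⟩, ncard_neighborSet_cliqueUnion X _⟩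
  · rintro ⟨a, rfl⟩
    rw [ncard_neighborSet_cliqueUnion]
    exact a.down.1.2

theorem mk_isoClass : Cardinal.mk IsoClass.{u} = 2 ^ Cardinal.aleph0 := by
  apply le_antisymm
  · refine Cardinal.mk_le_two_power_aleph0_of_relCode (f := fun q => relCode q.out.graph.Adj) ?_
    intro p q h
    obtain ⟨e⟩ := relIso_of_relCode_eq h
    rw [← p.out_eq, ← q.out_eq]
    exact Quotient.sound ⟨e⟩
  · refine Cardinal.two_power_aleph0_le_mk_of_injective (f := fun X => ⟦cliqueUnion X⟧) ?_
    have hsub : ∀ X Y : Set ℕ,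
        Nonempty ((cliqueUnion.{u} X).graph ≃g (cliqueUnion.{u} Y).graph) → X ⊆ Y := by
      rintro X Y ⟨e⟩ n hn
      obtain ⟨a, ha⟩ := (mem_iff_exists_ncard_neighborSet X n).1 hn
      refine (mem_iff_exists_ncard_neighborSet.{u} Y n).2 ⟨e a, ?_⟩
      rw [← ha]
      exact (Set.ncard_congr' (e.mapNeighborSet a)).symm
    intro X Y h
    have h' := Quotient.exact h
    exact (hsub X Y h').antisymm (hsub Y X (Setoid.symm h'))

end CountableGraph

namespace CountableLinearOrder

/-- The points of `ℕ ×ₗ ℚ` such that the fibre over `n ∈ X` consists of all rationals below `0`,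
followed by a chain with `n + 2` elements; the other fibres are empty. -/
def chainSet (X : Set ℕ) : Set (ℕ ×ₗ ℚ) :=
  {p | (ofLex p).1 ∈ X ∧ ((ofLex p).2 < 0 ∨ ∃ k : ℕ, k ≤ (ofLex p).1 + 1 ∧ (ofLex p).2 = k)}

/-- The set of those `n` for which there is a maximal chain of covers with `n + 2` elements. -/
def coverLengths (L : Type*) [LinearOrder L] : Set ℕ :=
  {n | ∃ c : ℕ → L, (∀ i ≤ n, c i ⋖ c (i + 1)) ∧ (∀ y, ¬ y ⋖ c 0) ∧ ∀ y, ¬ c (n + 1) ⋖ y}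

theorem coverLengths_subset_of_orderIso {L M : Type*} [LinearOrder L] [LinearOrder M]
    (e : L ≃o M) : coverLengths L ⊆ coverLengths M := by
  rintro n ⟨c, h1, h2, h3⟩
  refine ⟨fun i => e (c i), fun i hi => (apply_covBy_apply_iff e).2 (h1 i hi), fun y h => ?_,
    fun y h => ?_⟩
  · rw [← e.apply_symm_apply y, apply_covBy_apply_iff] at h
    exact h2 _ h
  · rw [← e.apply_symm_apply y, apply_covBy_apply_iff] at h
    exact h3 _ h

theorem coverLengths_eq_of_orderIso {L M : Type*} [LinearOrder L] [LinearOrder M]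
    (e : L ≃o M) : coverLengths L = coverLengths M :=
  (coverLengths_subset_of_orderIso e).antisymm (coverLengths_subset_of_orderIso e.symm)

/-- The negative rationals are dense without a last element, so they take part in no cover. They
also leave every fibre without a least element, so no cover crosses from one fibre to the next. -/
theorem chainSet_covBy_iff {X : Set ℕ} {m n : ℕ} {q r : ℚ} (hq : toLex (m, q) ∈ chainSet X)
    (hr : toLex (n, r) ∈ chainSet X) :
    (⟨toLex (m, q), hq⟩ : chainSet X) ⋖ ⟨toLex (n, r), hr⟩ ↔
      m = n ∧ ∃ k : ℕ, q = k ∧ r = k + 1 := by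
  constructor
  · rintro ⟨hlt, hno⟩
    have hno : ∀ (j : ℕ) (s : ℚ), toLex (j, s) ∈ chainSet X → toLex (m, q) < toLex (j, s) →
      ¬ toLex (j, s) < toLex (n, r) := fun j s hs h1 h2 => hno (c := ⟨toLex (j, s), hs⟩) h1 h2
    have hlt : toLex (m, q) < toLex (n, r) := hlt
    simp only [Prod.Lex.toLex_lt_toLex] at hlt hno
    have hmn : m = n := by
      rcases hlt with h | h
      · exfalso
        -- A negative rational below `r` in the upper fibre lies strictly between the two points.
        refine hno n (min (r - 1) (-1)) ⟨hr.1, Or.inl ?_⟩ (Or.inl h) (Or.inr ⟨rfl, ?_⟩)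
        · exact (min_le_right _ _).trans_lt (by norm_num)
        · exact (min_le_left _ _).trans_lt (by simp)
      · exact h.1
    subst hmn
    have hlt : q < r := by simpa using hlt
    have hno : ∀ s : ℚ, toLex (m, s) ∈ chainSet X → q < s → ¬ s < r := fun s hs h1 h2 =>
      hno m s hs (Or.inr ⟨rfl, h1⟩) (Or.inr ⟨rfl, h2⟩)
    refine ⟨rfl, ?_⟩
    rcases hq.2 with hq' | ⟨k, hk, hk'⟩
    · exfalso
      have hq' : q < 0 := hq'
      obtain ⟨s, h1, h2⟩ := exists_between (lt_min hlt hq')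
      exact hno s ⟨hq.1, Or.inl (h2.trans_le (min_le_right _ _))⟩ h1
        (h2.trans_le (min_le_left _ _))
    · have hk' : q = k := hk'
      subst hk'
      refine ⟨k, rfl, ?_⟩
      rcases hr.2 with hr' | ⟨l, hl, hl'⟩
      · have hr' : r < 0 := hr'
        have : (0 : ℚ) ≤ k := k.cast_nonneg
        linarith
      · have hl : l ≤ m + 1 := hl
        have hl' : r = l := hl'
        subst hl'
        have hkl : k + 1 ≤ l := by exact_mod_cast hlt
        have h2 := hno ((k + 1 : ℕ) : ℚ) ⟨hq.1, Or.inr ⟨k + 1, hkl.trans hl, rfl⟩⟩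
          (by exact_mod_cast Nat.lt_succ_self k)
        have h3 : l ≤ k + 1 := by exact_mod_cast not_lt.1 h2
        exact_mod_cast le_antisymm h3 hkl
  · rintro ⟨rfl, k, rfl, rfl⟩
    refine ⟨Prod.Lex.toLex_lt_toLex.2 (Or.inr ⟨rfl, by simp⟩), ?_⟩
    rintro ⟨s, hs⟩ h1 h2
    obtain ⟨⟨j, s⟩, rfl⟩ := toLex.surjective s
    have h1 : toLex (m, (k : ℚ)) < toLex (j, s) := h1
    have h2 : toLex (j, s) < toLex (m, (k : ℚ) + 1) := h2
    simp only [Prod.Lex.toLex_lt_toLex] at h1 h2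
    have hjm : j = m := by omega
    subst hjm
    have h1 : (k : ℚ) < s := by simpa using h1
    have h2 : s < (k : ℚ) + 1 := by simpa using h2
    rcases hs.2 with hs' | ⟨l, -, hl⟩
    · have hs' : s < 0 := hs'
      have : (0 : ℚ) ≤ k := k.cast_nonneg
      linarith
    · have hl : s = l := hl
      subst hl
      have h3 : k < l := by exact_mod_cast h1
      have h4 : l < k + 1 := by exact_mod_cast h2
      omega

/-- A maximal chain of covers is the whole integer part `0, …, m + 1` of a fibre. Having at least
two points makes it visible through covers even for `m = 0`. -/
theorem coverLengths_chainSet (X : Set ℕ) : coverLengths (chainSet X) = X := by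
  ext n
  constructor
  · rintro ⟨c, h1, h2, h3⟩
    obtain ⟨m, q, hq, h0⟩ : ∃ (m : ℕ) (q : ℚ) (hq : toLex (m, q) ∈ chainSet X),
        c 0 = ⟨toLex (m, q), hq⟩ := ⟨_, _, (c 0).2, rfl⟩
    -- The starting point is covered, hence a natural number; if positive, it would itself cover its
    -- predecessor.
    have hq0 : q = 0 := by
      have h := h1 0 (Nat.zero_le _)
      rw [h0] at h
      obtain ⟨-, k, hk, -⟩ := (chainSet_covBy_iff hq (c (0 + 1)).2).1 h
      rcases k with _ | k
      · simpa using hk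
      · exfalso
        have hk' : k ≤ m + 1 := by
          rcases hq.2 with hq' | ⟨l, hl, hl'⟩
          · have hq' : q < 0 := hq'
            have : (0 : ℚ) ≤ (k + 1 : ℕ) := Nat.cast_nonneg _
            linarith
          · have hl : l ≤ m + 1 := hl
            have hl' : q = l := hl'
            have : k + 1 = l := by exact_mod_cast hk.symm.trans hl'
            omega
        refine h2 ⟨toLex (m, (k : ℚ)), hq.1, Or.inr ⟨k, hk', rfl⟩⟩ ?_
        rw [h0]
        exact (chainSet_covBy_iff _ hq).2 ⟨rfl, k, rfl, by rw [hk]; push_cast; rfl⟩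
    subst hq0
    have hc : ∀ i ≤ n + 1, ((c i : chainSet X) : ℕ ×ₗ ℚ) = toLex (m, (i : ℚ)) := by
      intro i
      induction i with
      | zero => intro _; rw [h0]; simp
      | succ i ih =>
        intro hi
        have hi' := ih (by omega)
        have h := h1 i (by omega)
        obtain ⟨m', q', hq', hi1⟩ : ∃ (m' : ℕ) (q' : ℚ) (hq' : toLex (m', q') ∈ chainSet X),
          c (i + 1) = ⟨toLex (m', q'), hq'⟩ := ⟨_, _, (c (i + 1)).2, rfl⟩
        have hmem : toLex (m, (i : ℚ)) ∈ chainSet X := hi' ▸ (c i).2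
        rw [show c i = ⟨toLex (m, (i : ℚ)), hmem⟩ from Subtype.ext hi', hi1] at h
        obtain ⟨rfl, k, hk, hk'⟩ := (chainSet_covBy_iff hmem hq').1 h
        rw [hi1, Nat.cast_succ, hk, ← hk']
    have hlast := hc (n + 1) le_rfl
    have hmem : toLex (m, ((n + 1 : ℕ) : ℚ)) ∈ chainSet X := hlast ▸ (c (n + 1)).2
    have hnm : n ≤ m := by
      rcases hmem.2 with h | ⟨l, hl, hl'⟩
      · have h : ((n + 1 : ℕ) : ℚ) < 0 := h
        have : (0 : ℚ) ≤ (n + 1 : ℕ) := Nat.cast_nonneg _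
        linarith
      · have hl : l ≤ m + 1 := hl
        have hl' : ((n + 1 : ℕ) : ℚ) = l := hl'
        have : n + 1 = l := by exact_mod_cast hl'
        omega
    -- Otherwise `n + 2` is still in the fibre and covers the last element.
    have hmn : m ≤ n := by
      by_contra hlt
      refine h3 ⟨toLex (m, ((n + 2 : ℕ) : ℚ)), hq.1, Or.inr ⟨n + 2, ?_, rfl⟩⟩ ?_
      · change n + 2 ≤ m + 1
        omega
      · rw [show c (n + 1) = ⟨toLex (m, ((n + 1 : ℕ) : ℚ)), hmem⟩ from Subtype.ext hlast]
        exact (chainSet_covBy_iff _ _).2 ⟨rfl, n + 1, rfl, by push_cast; ring⟩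
    rw [le_antisymm hnm hmn]
    exact hq.1
  · intro hn
    -- The sequence must be defined on all of `ℕ`; truncating at `n + 1` keeps it in the fibre, and
    -- only indices up to `n + 1` matter.
    have hmem : ∀ i, toLex (n, ((min i (n + 1) : ℕ) : ℚ)) ∈ chainSet X := fun i =>
      ⟨hn, Or.inr ⟨_, min_le_right _ _, rfl⟩⟩
    refine ⟨fun i => ⟨_, hmem i⟩, fun i hi => ?_, ?_, ?_⟩
    · rw [chainSet_covBy_iff]
      refine ⟨rfl, i, ?_, ?_⟩
      · rw [min_eq_left (by omega)]
      · rw [min_eq_left (by omega)]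
        push_cast
        rfl
    · rintro ⟨y, hy⟩ h
      obtain ⟨⟨m, q⟩, rfl⟩ := toLex.surjective y
      obtain ⟨-, k, -, hk⟩ := (chainSet_covBy_iff hy (hmem 0)).1 h
      have : (0 : ℚ) ≤ k := k.cast_nonneg
      simp at hk
      linarith
    · rintro ⟨y, hy⟩ h
      obtain ⟨⟨m, q⟩, rfl⟩ := toLex.surjective y
      obtain ⟨rfl, k, hk, rfl⟩ := (chainSet_covBy_iff (hmem (n + 1)) hy).1 h
      rw [min_self] at hk
      have hk : n + 1 = k := by exact_mod_cast hk
      subst hk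
      rcases hy.2 with h | ⟨l, hl, hl'⟩
      · have h : ((n + 1 : ℕ) : ℚ) + 1 < 0 := h
        have : (0 : ℚ) ≤ (n + 1 : ℕ) := Nat.cast_nonneg _
        linarith
      · have hl : l ≤ n + 1 := hl
        have hl' : ((n + 1 : ℕ) : ℚ) + 1 = l := hl'
        have : n + 1 + 1 = l := by exact_mod_cast hl'
        omega

/-- The linear order with underlying set `chainSet X`. -/
noncomputable def chainSum (X : Set ℕ) : CountableLinearOrder.{u} :=
  have : Countable (ℕ ×ₗ ℚ) := inferInstanceAs (Countable (ℕ × ℚ))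
  { carrier := ULift (chainSet X) }

theorem mk_isoClass : Cardinal.mk IsoClass.{u} = 2 ^ Cardinal.aleph0 := by
  apply le_antisymm
  -- Coding `≤` rather than `<` makes the relation isomorphism an order isomorphism as it stands.
  · refine Cardinal.mk_le_two_power_aleph0_of_relCode
      (f := fun q => relCode fun x y : q.out.carrier => x ≤ y) ?_
    intro p q h
    obtain ⟨e⟩ := relIso_of_relCode_eq h
    rw [← p.out_eq, ← q.out_eq]
    exact Quotient.sound ⟨e⟩
  · refine Cardinal.two_power_aleph0_le_mk_of_injective (f := fun X => ⟦chainSum X⟧) ?_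
    intro X Y h
    obtain ⟨e⟩ := Quotient.exact h
    have e' : ULift.{u} (chainSet X) ≃o ULift.{u} (chainSet Y) := e
    rw [← coverLengths_chainSet X, ← coverLengths_chainSet Y]
    exact coverLengths_eq_of_orderIso ((ULift.orderIso.symm.trans e').trans ULift.orderIso)

end CountableLinearOrder

/-! ### The induced maps on isomorphism classes and the final count. -/

namespace CountableGraph

theorem exists_disjointUnion_map {W : Type} [Countable W] {Γ : SimpleGraph W}
    (hΓ : IsRandomGraph Γ) : ∃ F : IsoClass.{u} → SymIndivIsoClass.{u},
      (∀ G : CountableGraph.{u}, (F ⟦G⟧ : IsoClass.{u}) = ⟦G.disjointUnion Γ⟧) ∧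
      Function.Injective F ∧ Cardinal.mk (Set.range F) = 2 ^ Cardinal.aleph0 := by
  let F : IsoClass.{u} → SymIndivIsoClass.{u} := Quotient.lift
    (fun G => ⟨⟦G.disjointUnion Γ⟧, G.disjointUnion Γ, rfl,
      symmetricallyIndivisible_disjointUnion hΓ G⟩)
    (fun G G' ⟨e⟩ => Subtype.ext (Quotient.sound ⟨SimpleGraph.Iso.sumCongr (RelIso.refl _) e⟩))
  have hF : Function.Injective F := by
    intro p q
    induction p using Quotient.inductionOn
    induction q using Quotient.inductionOn
    intro h
    obtain ⟨e⟩ := Quotient.exact (congrArg Subtype.val h)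
    exact Quotient.sound (iso_of_disjointUnion_iso hΓ e)
  exact ⟨F, fun G => rfl, hF, (Cardinal.mk_range_eq F hF).trans mk_isoClass⟩

end CountableGraph

namespace CountableLinearOrder

theorem exists_concat_map : ∃ F : IsoClass.{u} → SymIndivIsoClass.{u},
      (∀ A : CountableLinearOrder.{u}, (F ⟦A⟧ : IsoClass.{u}) = ⟦A.concat⟧) ∧
      Function.Injective F ∧ Cardinal.mk (Set.range F) = 2 ^ Cardinal.aleph0 := by
  let F : IsoClass.{u} → SymIndivIsoClass.{u} := Quotient.lift
    (fun A => ⟨⟦A.concat⟧, A.concat, rfl, symmetricallyIndivisible_concat A⟩)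
    (fun A A' ⟨e⟩ => Subtype.ext (Quotient.sound
      ⟨(OrderIso.refl (ℚ ⊕ₗ Fin 2)).sumLexCongr e⟩))
  have hF : Function.Injective F := by
    intro p q
    induction p using Quotient.inductionOn
    induction q using Quotient.inductionOn
    intro h
    obtain ⟨e⟩ := Quotient.exact (congrArg Subtype.val h)
    exact Quotient.sound (iso_of_concat_iso e)
  exact ⟨F, fun A => rfl, hF, (Cardinal.mk_range_eq F hF).trans mk_isoClass⟩

end CountableLinearOrder

theorem mainTheorem2 :
    (∀ (W : Type) [Countable W] (Γ : SimpleGraph W), IsRandomGraph Γ →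
      ∃ F : CountableGraph.IsoClass.{u} → CountableGraph.SymIndivIsoClass.{u},
        (∀ G : CountableGraph.{u}, (F ⟦G⟧ : CountableGraph.IsoClass.{u}) = ⟦G.disjointUnion Γ⟧) ∧
        Function.Injective F ∧
        Cardinal.mk (Set.range F) = 2 ^ Cardinal.aleph0) ∧
    (∃ F : CountableLinearOrder.IsoClass.{u} → CountableLinearOrder.SymIndivIsoClass.{u},
        (∀ A : CountableLinearOrder.{u},
          (F ⟦A⟧ : CountableLinearOrder.IsoClass.{u}) = ⟦A.concat⟧) ∧
        Function.Injective F ∧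
        Cardinal.mk (Set.range F) = 2 ^ Cardinal.aleph0) ∧
    Cardinal.mk CountableGraph.SymIndivIsoClass.{u} = 2 ^ Cardinal.aleph0 ∧
    Cardinal.mk CountableLinearOrder.SymIndivIsoClass.{u} = 2 ^ Cardinal.aleph0 := by
  refine ⟨fun W _ Γ hΓ => CountableGraph.exists_disjointUnion_map hΓ,
    CountableLinearOrder.exists_concat_map, ?_, ?_⟩
  · obtain ⟨Γ, hΓ⟩ := exists_isRandomGraph
    obtain ⟨F, -, -, hF⟩ := CountableGraph.exists_disjointUnion_map.{u} hΓ
    exact ((Cardinal.mk_subtype_le _).trans_eq CountableGraph.mk_isoClass).antisymm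
      (hF.symm.trans_le (Cardinal.mk_set_le _))
  · obtain ⟨F, -, -, hF⟩ := CountableLinearOrder.exists_concat_map.{u}
    exact ((Cardinal.mk_subtype_le _).trans_eq CountableLinearOrder.mk_isoClass).antisymm
      (hF.symm.trans_le (Cardinal.mk_set_le _))
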